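/- Let $\mathbb{H}_{ss}$ be the algebra of split semi-quaternions: the associative unital $\mathbb{R}$-algebra with basis $e_0=1,e_1,e_2,e_3$ and products $$e_1^2=1,\quad e_2^2=e_3^2=0,\quad e_1e_2=e_3=-e_2e_1,\quad e_2e_3=e_3e_2=0,\quad e_1e_3=e_2=-e_3e_1.$$ For $\lambda\in\mathbb{R}$, a Rota-Baxter operator of weight $\lambda$ on $\mathbb{H}_{ss}$ is an $\mathbb{R}$-linear map $\mathcal{P}:\mathbb{H}_{ss}\to\mathbb{H}_{ss}$ with $$\mathcal{P}(x)\mathcal{P}(y)=\mathcal{P}(\mathcal{P}(x)y)+\mathcal{P}(x\mathcal{P}(y))+\lambda\mathcal{P}(xy)\qquad\text{for all }x,y\in\mathbb{H}_{ss}.$$ Let $P$ be the matrix of $\mathcal{P}$ with respect to $e_0,e_1,e_2,e_3$; its columns are the coordinate vectors of $\mathcal{P}(e_0),\mathcal{P}(e_1),\mathcal{P}(e_2),\mathcal{P}(e_3)$. **Theorem.** Let $\lambda\in\mathbb{R}$ with $\lambda\neq 0$, and let $\mathcal{P}$ be an $\mathbb{R}$-linear map on $\mathbb{H}_{ss}$.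 Then $\mathcal{P}$ is a Rota-Baxter operator of weight $\lambda$ on $\mathbb{H}_{ss}$ if and only if $P$ is one of the following matrices, for some real parameters $a,b,c$ satisfying the condition stated for its group. (Some matrices are repeated.) (i) With $a,b\in\mathbb{R}$ arbitrary: $$\begin{pmatrix}0&-\lambda&0&0\\0&-\lambda&0&0\\0&a&0&0\\0&b&0&0\end{pmatrix}, \begin{pmatrix}0&\lambda&0&0\\0&-\lambda&0&0\\0&a&0&0\\0&b&0&0\end{pmatrix}, \begin{pmatrix}-\lambda&0&0&0\\0&-\lambda&0&0\\0&a&0&0\\0&b&0&0\end{pmatrix}, \begin{pmatrix}0&0&0&0\\0&0&0&0\\0&a&-\lambda&0\\0&b&0&-\lambda\end{pmatrix},$$ $$\begin{pmatrix}-\lambda&-\lambda&0&0\\0&0&0&0\\0&a&-\lambda&0\\0&b&0&-\lambda\end{pmatrix}, \begin{pmatrix}-\lambda&\lambda&0&0\\0&0&0&0\\0&a&-\lambda&0\\0&b&0&-\lambda\end{pmatrix}, \begin{pmatrix}0&-\lambda&0&0\\0&-\lambda&0&0\\0&0&-\lambda&0\\0&a&-\lambda&0\end{pmatrix}, \begin{pmatrix}0&\lambda&0&0\\0&-\lambda&0&0\\0&0&-\lambda&0\\0&a&-\lambda&0\end{pmatrix},$$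 $$\begin{pmatrix}0&-\lambda&0&0\\0&-\lambda&0&0\\0&0&-\lambda&0\\0&a&\lambda&0\end{pmatrix}, \begin{pmatrix}0&\lambda&0&0\\0&-\lambda&0&0\\0&0&-\lambda&0\\0&a&\lambda&0\end{pmatrix}, \begin{pmatrix}-\lambda&0&0&0\\0&-\lambda&0&0\\0&0&-\lambda&0\\0&a&-\lambda&0\end{pmatrix}, \begin{pmatrix}-\lambda&0&0&0\\0&-\lambda&0&0\\0&0&-\lambda&0\\0&a&\lambda&0\end{pmatrix},$$ $$\begin{pmatrix}0&0&0&0\\0&0&0&0\\0&0&0&0\\0&a&-\lambda&-\lambda\end{pmatrix}, \begin{pmatrix}0&0&0&0\\0&0&0&0\\0&0&0&0\\0&a&\lambda&-\lambda\end{pmatrix}, \begin{pmatrix}-\lambda&-\lambda&0&0\\0&0&0&0\\0&0&0&0\\0&a&-\lambda&-\lambda\end{pmatrix}, \begin{pmatrix}-\lambda&\lambda&0&0\\0&0&0&0\\0&0&0&0\\0&a&-\lambda&-\lambda\end{pmatrix},$$ $$\begin{pmatrix}-\lambda&-\lambda&0&0\\0&0&0&0\\0&0&0&0\\0&a&\lambda&-\lambda\end{pmatrix},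 \begin{pmatrix}-\lambda&\lambda&0&0\\0&0&0&0\\0&0&0&0\\0&a&\lambda&-\lambda\end{pmatrix}, \begin{pmatrix}0&0&0&0\\0&0&0&0\\0&0&0&0\\0&0&0&0\end{pmatrix}, \begin{pmatrix}-\lambda&0&0&0\\0&-\lambda&0&0\\0&0&-\lambda&0\\0&0&0&-\lambda\end{pmatrix},$$ $$\begin{pmatrix}-\lambda&-\lambda&0&0\\0&0&0&0\\0&0&0&0\\0&0&0&0\end{pmatrix}, \begin{pmatrix}-\lambda&\lambda&0&0\\0&0&0&0\\0&0&0&0\\0&0&0&0\end{pmatrix}, \begin{pmatrix}0&-\lambda&0&0\\0&-\lambda&0&0\\0&0&-\lambda&0\\0&0&0&-\lambda\end{pmatrix}, \begin{pmatrix}0&\lambda&0&0\\0&-\lambda&0&0\\0&0&-\lambda&0\\0&0&0&-\lambda\end{pmatrix},$$ $$\begin{pmatrix}-\frac{3\lambda}{2}&\frac{\lambda}{2}&0&0\\-\frac{\lambda}{2}&-\frac{\lambda}{2}&0&0\\a&a&0&0\\b&b&0&0\end{pmatrix}, \begin{pmatrix}\frac{\lambda}{2}&\frac{\lambda}{2}&0&0\\-\frac{\lambda}{2}&-\frac{\lambda}{2}&0&0\\a&a&0&0\\b&b&0&0\end{pmatrix},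 \begin{pmatrix}-\frac{3\lambda}{2}&\frac{\lambda}{2}&0&0\\-\frac{\lambda}{2}&-\frac{\lambda}{2}&0&0\\a&-a&-\lambda&0\\b&-b&0&-\lambda\end{pmatrix}, \begin{pmatrix}\frac{\lambda}{2}&\frac{\lambda}{2}&0&0\\-\frac{\lambda}{2}&-\frac{\lambda}{2}&0&0\\a&-a&-\lambda&0\\b&-b&0&-\lambda\end{pmatrix},$$ $$\begin{pmatrix}-\frac{\lambda}{2}&-\frac{\lambda}{2}&0&0\\-\frac{\lambda}{2}&-\frac{\lambda}{2}&0&0\\a&-b&-\frac{\lambda}{2}&-\frac{\lambda}{2}\\b&-a&-\frac{\lambda}{2}&-\frac{\lambda}{2}\end{pmatrix}, \begin{pmatrix}-\frac{\lambda}{2}&-\frac{\lambda}{2}&0&0\\-\frac{\lambda}{2}&-\frac{\lambda}{2}&0&0\\a&b&-\frac{\lambda}{2}&\frac{\lambda}{2}\\b&a&\frac{\lambda}{2}&-\frac{\lambda}{2}\end{pmatrix}, \begin{pmatrix}-\frac{3\lambda}{2}&\frac{\lambda}{2}&0&0\\-\frac{\lambda}{2}&-\frac{\lambda}{2}&0&0\\a&-b&-\frac{\lambda}{2}&-\frac{\lambda}{2}\\b&-a&-\frac{\lambda}{2}&-\frac{\lambda}{2}\end{pmatrix},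 \begin{pmatrix}\frac{\lambda}{2}&\frac{\lambda}{2}&0&0\\-\frac{\lambda}{2}&-\frac{\lambda}{2}&0&0\\a&-b&-\frac{\lambda}{2}&-\frac{\lambda}{2}\\b&-a&-\frac{\lambda}{2}&-\frac{\lambda}{2}\end{pmatrix},$$ $$\begin{pmatrix}-\frac{3\lambda}{2}&\frac{\lambda}{2}&0&0\\-\frac{\lambda}{2}&-\frac{\lambda}{2}&0&0\\a&b&-\frac{\lambda}{2}&\frac{\lambda}{2}\\b&a&\frac{\lambda}{2}&-\frac{\lambda}{2}\end{pmatrix}, \begin{pmatrix}\frac{\lambda}{2}&\frac{\lambda}{2}&0&0\\-\frac{\lambda}{2}&-\frac{\lambda}{2}&0&0\\a&b&-\frac{\lambda}{2}&\frac{\lambda}{2}\\b&a&\frac{\lambda}{2}&-\frac{\lambda}{2}\end{pmatrix}, \begin{pmatrix}-\frac{3\lambda}{2}&-\frac{\lambda}{2}&0&0\\\frac{\lambda}{2}&-\frac{\lambda}{2}&0&0\\a&-a&0&0\\b&-b&0&0\end{pmatrix}, \begin{pmatrix}\frac{\lambda}{2}&-\frac{\lambda}{2}&0&0\\\frac{\lambda}{2}&-\frac{\lambda}{2}&0&0\\a&-a&0&0\\b&-b&0&0\end{pmatrix},$$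 $$\begin{pmatrix}-\frac{3\lambda}{2}&-\frac{\lambda}{2}&0&0\\\frac{\lambda}{2}&-\frac{\lambda}{2}&0&0\\a&a&-\lambda&0\\b&b&0&-\lambda\end{pmatrix}, \begin{pmatrix}\frac{\lambda}{2}&-\frac{\lambda}{2}&0&0\\\frac{\lambda}{2}&-\frac{\lambda}{2}&0&0\\a&a&-\lambda&0\\b&b&0&-\lambda\end{pmatrix}, \begin{pmatrix}-\frac{\lambda}{2}&\frac{\lambda}{2}&0&0\\\frac{\lambda}{2}&-\frac{\lambda}{2}&0&0\\a&b&-\frac{\lambda}{2}&-\frac{\lambda}{2}\\b&a&-\frac{\lambda}{2}&-\frac{\lambda}{2}\end{pmatrix}, \begin{pmatrix}-\frac{\lambda}{2}&\frac{\lambda}{2}&0&0\\\frac{\lambda}{2}&-\frac{\lambda}{2}&0&0\\a&-b&-\frac{\lambda}{2}&\frac{\lambda}{2}\\b&-a&\frac{\lambda}{2}&-\frac{\lambda}{2}\end{pmatrix},$$ $$\begin{pmatrix}-\frac{3\lambda}{2}&-\frac{\lambda}{2}&0&0\\\frac{\lambda}{2}&-\frac{\lambda}{2}&0&0\\a&b&-\frac{\lambda}{2}&-\frac{\lambda}{2}\\b&a&-\frac{\lambda}{2}&-\frac{\lambda}{2}\end{pmatrix},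 \begin{pmatrix}\frac{\lambda}{2}&-\frac{\lambda}{2}&0&0\\\frac{\lambda}{2}&-\frac{\lambda}{2}&0&0\\a&b&-\frac{\lambda}{2}&-\frac{\lambda}{2}\\b&a&-\frac{\lambda}{2}&-\frac{\lambda}{2}\end{pmatrix}, \begin{pmatrix}-\frac{3\lambda}{2}&-\frac{\lambda}{2}&0&0\\\frac{\lambda}{2}&-\frac{\lambda}{2}&0&0\\a&-b&-\frac{\lambda}{2}&\frac{\lambda}{2}\\b&-a&\frac{\lambda}{2}&-\frac{\lambda}{2}\end{pmatrix}, \begin{pmatrix}\frac{\lambda}{2}&-\frac{\lambda}{2}&0&0\\\frac{\lambda}{2}&-\frac{\lambda}{2}&0&0\\a&-b&-\frac{\lambda}{2}&\frac{\lambda}{2}\\b&-a&\frac{\lambda}{2}&-\frac{\lambda}{2}\end{pmatrix},$$ $$\begin{pmatrix}-\frac{3\lambda}{2}&\frac{\lambda}{2}&0&0\\-\frac{\lambda}{2}&-\frac{\lambda}{2}&0&0\\a&a&0&0\\b&b&0&0\end{pmatrix}, \begin{pmatrix}\frac{\lambda}{2}&\frac{\lambda}{2}&0&0\\-\frac{\lambda}{2}&-\frac{\lambda}{2}&0&0\\a&a&0&0\\b&b&0&0\end{pmatrix},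 \begin{pmatrix}-\frac{3\lambda}{2}&\frac{\lambda}{2}&0&0\\-\frac{\lambda}{2}&-\frac{\lambda}{2}&0&0\\a&-a&-\lambda&0\\b&-b&0&-\lambda\end{pmatrix}, \begin{pmatrix}\frac{\lambda}{2}&\frac{\lambda}{2}&0&0\\-\frac{\lambda}{2}&-\frac{\lambda}{2}&0&0\\a&-a&-\lambda&0\\b&-b&0&-\lambda\end{pmatrix},$$ $$\begin{pmatrix}-\frac{\lambda}{2}&-\frac{\lambda}{2}&0&0\\-\frac{\lambda}{2}&-\frac{\lambda}{2}&0&0\\a&a&0&0\\b&b&0&0\end{pmatrix}, \begin{pmatrix}-\frac{\lambda}{2}&-\frac{\lambda}{2}&0&0\\-\frac{\lambda}{2}&-\frac{\lambda}{2}&0&0\\a&-a&-\lambda&0\\b&-b&0&-\lambda\end{pmatrix}, \begin{pmatrix}-\frac{\lambda}{2}&\frac{\lambda}{2}&0&0\\\frac{\lambda}{2}&-\frac{\lambda}{2}&0&0\\a&-a&0&0\\b&-b&0&0\end{pmatrix}, \begin{pmatrix}-\frac{\lambda}{2}&\frac{\lambda}{2}&0&0\\\frac{\lambda}{2}&-\frac{\lambda}{2}&0&0\\a&a&-\lambda&0\\b&b&0&-\lambda\end{pmatrix}.$$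 (ii) With $a,b,c\in\mathbb{R}$ and $a\neq 0$: $$\begin{pmatrix}0&-b&a&-a\\0&b&-a&a\\0&\frac{(b - c)(b + \lambda)}{a}&-b + c - \lambda&b - c\\0&-\frac{c(b + \lambda)}{a}&c&-c - \lambda\end{pmatrix}, \begin{pmatrix}0&-b&a&-a\\0&b&-a&a\\0&\frac{b(b - c + \lambda)}{a}&-b + c - \lambda&b - c + \lambda\\0&-\frac{bc}{a}&c&-c\end{pmatrix}, \begin{pmatrix}-\lambda&-b - \lambda&a&-a\\0&b&-a&a\\0&\frac{(b - c)(b + \lambda)}{a}&-b + c - \lambda&b - c\\0&-\frac{c(b + \lambda)}{a}&c&-c - \lambda\end{pmatrix}, \begin{pmatrix}-\lambda&-b - \lambda&a&-a\\0&b&-a&a\\0&\frac{b(b - c + \lambda)}{a}&-b + c - \lambda&b - c + \lambda\\0&-\frac{bc}{a}&c&-c\end{pmatrix},$$ $$\begin{pmatrix}0&b&a&-a\\0&b&a&-a\\0&-\frac{(b - c)(b + \lambda)}{a}&-b + c - \lambda&b - c\\0&\frac{c(b + \lambda)}{a}&c&-c - \lambda\end{pmatrix}, \begin{pmatrix}0&b&a&-a\\0&b&a&-a\\0&-\frac{b(b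 - c + \lambda)}{a}&-b + c - \lambda&b - c + \lambda\\0&\frac{bc}{a}&c&-c\end{pmatrix}, \begin{pmatrix}-\lambda&b + \lambda&a&-a\\0&b&a&-a\\0&-\frac{(b - c)(b + \lambda)}{a}&-b + c - \lambda&b - c\\0&\frac{c(b + \lambda)}{a}&c&-c - \lambda\end{pmatrix}, \begin{pmatrix}-\lambda&b + \lambda&a&-a\\0&b&a&-a\\0&-\frac{b(b - c + \lambda)}{a}&-b + c - \lambda&b - c + \lambda\\0&\frac{bc}{a}&c&-c\end{pmatrix},$$ $$\begin{pmatrix}0&-b&a&a\\0&b&-a&-a\\0&\frac{(b + c)(b + \lambda)}{a}&-b - c - \lambda&-b - c\\0&-\frac{c(b + \lambda)}{a}&c&c - \lambda\end{pmatrix}, \begin{pmatrix}0&-b&a&a\\0&b&-a&-a\\0&\frac{b(b + c + \lambda)}{a}&-b - c - \lambda&-b - c - \lambda\\0&-\frac{bc}{a}&c&c\end{pmatrix}, \begin{pmatrix}-\lambda&-b - \lambda&a&a\\0&b&-a&-a\\0&\frac{(b + c)(b + \lambda)}{a}&-b - c - \lambda&-b - c\\0&-\frac{c(b + \lambda)}{a}&c&c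 - \lambda\end{pmatrix}, \begin{pmatrix}-\lambda&-b - \lambda&a&a\\0&b&-a&-a\\0&\frac{b(b + c + \lambda)}{a}&-b - c - \lambda&-b - c - \lambda\\0&-\frac{bc}{a}&c&c\end{pmatrix},$$ $$\begin{pmatrix}0&b&a&a\\0&b&a&a\\0&-\frac{(b + c)(b + \lambda)}{a}&-b - c - \lambda&-b - c\\0&\frac{c(b + \lambda)}{a}&c&c - \lambda\end{pmatrix}, \begin{pmatrix}0&b&a&a\\0&b&a&a\\0&-\frac{b(b + c + \lambda)}{a}&-b - c - \lambda&-b - c - \lambda\\0&\frac{bc}{a}&c&c\end{pmatrix}, \begin{pmatrix}-\lambda&b + \lambda&a&a\\0&b&a&a\\0&-\frac{(b + c)(b + \lambda)}{a}&-b - c - \lambda&-b - c\\0&\frac{c(b + \lambda)}{a}&c&c - \lambda\end{pmatrix}, \begin{pmatrix}-\lambda&b + \lambda&a&a\\0&b&a&a\\0&-\frac{b(b + c + \lambda)}{a}&-b - c - \lambda&-b - c - \lambda\\0&\frac{bc}{a}&c&c\end{pmatrix}.$$ (iii) With $a,b\in\mathbb{R}$ and $b+\lambda\neq 0$: $$\begin{pmatrix}0&-\lambda&0&0\\0&-\lambda&0&0\\0&a&b&-b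 - \lambda\\0&\frac{ab}{b + \lambda}&b&-b - \lambda\end{pmatrix}, \begin{pmatrix}0&\lambda&0&0\\0&-\lambda&0&0\\0&a&b&-b - \lambda\\0&\frac{ab}{b + \lambda}&b&-b - \lambda\end{pmatrix}, \begin{pmatrix}-\lambda&0&0&0\\0&-\lambda&0&0\\0&a&b&-b - \lambda\\0&\frac{ab}{b + \lambda}&b&-b - \lambda\end{pmatrix}, \begin{pmatrix}0&0&0&0\\0&0&0&0\\0&a&-b - \lambda&-b - \lambda\\0&-\frac{ab}{b + \lambda}&b&b\end{pmatrix},$$ $$\begin{pmatrix}-\lambda&-\lambda&0&0\\0&0&0&0\\0&a&-b - \lambda&-b - \lambda\\0&-\frac{ab}{b + \lambda}&b&b\end{pmatrix}, \begin{pmatrix}-\lambda&\lambda&0&0\\0&0&0&0\\0&a&-b - \lambda&-b - \lambda\\0&-\frac{ab}{b + \lambda}&b&b\end{pmatrix}.$$ (iv) With $a,b\in\mathbb{R}$ and $\lambda-b\neq 0$: $$\begin{pmatrix}0&-\lambda&0&0\\0&-\lambda&0&0\\0&a&-b&\lambda - b\\0&\frac{ab}{\lambda - b}&b&b - \lambda\end{pmatrix},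 \begin{pmatrix}0&\lambda&0&0\\0&-\lambda&0&0\\0&a&-b&\lambda - b\\0&\frac{ab}{\lambda - b}&b&b - \lambda\end{pmatrix}, \begin{pmatrix}-\lambda&0&0&0\\0&-\lambda&0&0\\0&a&-b&\lambda - b\\0&\frac{ab}{\lambda - b}&b&b - \lambda\end{pmatrix}, \begin{pmatrix}0&0&0&0\\0&0&0&0\\0&a&b - \lambda&\lambda - b\\0&-\frac{ab}{\lambda - b}&b&-b\end{pmatrix},$$ $$\begin{pmatrix}-\lambda&-\lambda&0&0\\0&0&0&0\\0&a&b - \lambda&\lambda - b\\0&-\frac{ab}{\lambda - b}&b&-b\end{pmatrix}, \begin{pmatrix}-\lambda&\lambda&0&0\\0&0&0&0\\0&a&b - \lambda&\lambda - b\\0&-\frac{ab}{\lambda - b}&b&-b\end{pmatrix}.$$ -/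

import Mathlib

/-- The split semi-quaternions: real quaternions `a₀ + a₁ e₁ + a₂ e₂ + a₃ e₃` with `e₁² = 1`,
`e₂² = e₃² = 0`, `e₁ e₂ = e₃ = -e₂ e₁`, `e₂ e₃ = e₃ e₂ = 0` and `e₁ e₃ = e₂ = -e₃ e₁`.
This is the generalized quaternion algebra with `i² = 1`, `j² = 0` and `i j = k = -j i`. -/
abbrev SplitSemiQuaternion : Type := QuaternionAlgebra ℝ 1 0 0

namespace SplitSemiQuaternion

/-- The ordered basis `e₀ = 1, e₁, e₂, e₃`. -/
noncomputable abbrev stdBasis : Module.Basis (Fin 4) ℝ SplitSemiQuaternion :=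
  QuaternionAlgebra.basisOneIJK 1 0 0

/-- The product of two split semi-quaternions in coordinates. -/
theorem mk_mul_mk (a₀ a₁ a₂ a₃ b₀ b₁ b₂ b₃ : ℝ) :
    (⟨a₀, a₁, a₂, a₃⟩ * ⟨b₀, b₁, b₂, b₃⟩ : SplitSemiQuaternion) =
      ⟨a₀ * b₀ + a₁ * b₁, a₁ * b₀ + a₀ * b₁,
        a₂ * b₀ - a₃ * b₁ + a₀ * b₂ + a₁ * b₃,
        a₃ * b₀ - a₂ * b₁ + a₁ * b₂ + a₀ * b₃⟩ := by
  ext <;> simp <;> ring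

end SplitSemiQuaternion

/-- A linear operator `P` on an associative real algebra is a Rota-Baxter operator of weight `l`
if `P(x) P(y) = P(P(x) y) + P(x P(y)) + l P(x y)` for all `x` and `y`. -/
def IsRotaBaxter {A : Type*} [Ring A] [Algebra ℝ A] (l : ℝ) (P : A →ₗ[ℝ] A) : Prop :=
  ∀ x y : A, P x * P y = P (P x * y) + P (x * P y) + l • P (x * y)

/-- The matrices of the classification whose entries are polynomial in the weight `l` and the
parameters `a`, `b`. -/
noncomputable def polynomialFamilies (l a b : ℝ) : Set (Matrix (Fin 4) (Fin 4) ℝ) :=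
  { !![0, -l, 0, 0; 0, -l, 0, 0; 0, a, 0, 0; 0, b, 0, 0],
    !![0, l, 0, 0; 0, -l, 0, 0; 0, a, 0, 0; 0, b, 0, 0],
    !![-l, 0, 0, 0; 0, -l, 0, 0; 0, a, 0, 0; 0, b, 0, 0],
    !![0, 0, 0, 0; 0, 0, 0, 0; 0, a, -l, 0; 0, b, 0, -l],
    !![-l, -l, 0, 0; 0, 0, 0, 0; 0, a, -l, 0; 0, b, 0, -l],
    !![-l, l, 0, 0; 0, 0, 0, 0; 0, a, -l, 0; 0, b, 0, -l],
    !![0, -l, 0, 0; 0, -l, 0, 0; 0, 0, -l, 0; 0, a, -l, 0],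
    !![0, l, 0, 0; 0, -l, 0, 0; 0, 0, -l, 0; 0, a, -l, 0],
    !![0, -l, 0, 0; 0, -l, 0, 0; 0, 0, -l, 0; 0, a, l, 0],
    !![0, l, 0, 0; 0, -l, 0, 0; 0, 0, -l, 0; 0, a, l, 0],
    !![-l, 0, 0, 0; 0, -l, 0, 0; 0, 0, -l, 0; 0, a, -l, 0],
    !![-l, 0, 0, 0; 0, -l, 0, 0; 0, 0, -l, 0; 0, a, l, 0],
    !![0, 0, 0, 0; 0, 0, 0, 0; 0, 0, 0, 0; 0, a, -l, -l],
    !![0, 0, 0, 0; 0, 0, 0, 0; 0, 0, 0, 0; 0, a, l, -l],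
    !![-l, -l, 0, 0; 0, 0, 0, 0; 0, 0, 0, 0; 0, a, -l, -l],
    !![-l, l, 0, 0; 0, 0, 0, 0; 0, 0, 0, 0; 0, a, -l, -l],
    !![-l, -l, 0, 0; 0, 0, 0, 0; 0, 0, 0, 0; 0, a, l, -l],
    !![-l, l, 0, 0; 0, 0, 0, 0; 0, 0, 0, 0; 0, a, l, -l],
    !![0, 0, 0, 0; 0, 0, 0, 0; 0, 0, 0, 0; 0, 0, 0, 0],
    !![-l, 0, 0, 0; 0, -l, 0, 0; 0, 0, -l, 0; 0, 0, 0, -l],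
    !![-l, -l, 0, 0; 0, 0, 0, 0; 0, 0, 0, 0; 0, 0, 0, 0],
    !![-l, l, 0, 0; 0, 0, 0, 0; 0, 0, 0, 0; 0, 0, 0, 0],
    !![0, -l, 0, 0; 0, -l, 0, 0; 0, 0, -l, 0; 0, 0, 0, -l],
    !![0, l, 0, 0; 0, -l, 0, 0; 0, 0, -l, 0; 0, 0, 0, -l],
    !![-(3 * l / 2), l / 2, 0, 0; -(l / 2), -(l / 2), 0, 0; a, a, 0, 0; b, b, 0, 0],
    !![l / 2, l / 2, 0, 0; -(l / 2), -(l / 2), 0, 0; a, a, 0, 0; b, b, 0, 0],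
    !![-(3 * l / 2), l / 2, 0, 0; -(l / 2), -(l / 2), 0, 0; a, -a, -l, 0; b, -b, 0, -l],
    !![l / 2, l / 2, 0, 0; -(l / 2), -(l / 2), 0, 0; a, -a, -l, 0; b, -b, 0, -l],
    !![-(l / 2), -(l / 2), 0, 0; -(l / 2), -(l / 2), 0, 0; a, -b, -(l / 2), -(l / 2); b, -a, -(l / 2), -(l / 2)],
    !![-(l / 2), -(l / 2), 0, 0; -(l / 2), -(l / 2), 0, 0; a, b, -(l / 2), l / 2; b, a, l / 2, -(l / 2)],
    !![-(3 * l / 2), l / 2, 0, 0; -(l / 2), -(l / 2), 0, 0; a, -b, -(l / 2), -(l / 2); b, -a, -(l / 2), -(l / 2)],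
    !![l / 2, l / 2, 0, 0; -(l / 2), -(l / 2), 0, 0; a, -b, -(l / 2), -(l / 2); b, -a, -(l / 2), -(l / 2)],
    !![-(3 * l / 2), l / 2, 0, 0; -(l / 2), -(l / 2), 0, 0; a, b, -(l / 2), l / 2; b, a, l / 2, -(l / 2)],
    !![l / 2, l / 2, 0, 0; -(l / 2), -(l / 2), 0, 0; a, b, -(l / 2), l / 2; b, a, l / 2, -(l / 2)],
    !![-(3 * l / 2), -(l / 2), 0, 0; l / 2, -(l / 2), 0, 0; a, -a, 0, 0; b, -b, 0, 0],
    !![l / 2, -(l / 2), 0, 0; l / 2, -(l / 2), 0, 0; a, -a, 0, 0; b, -b, 0, 0],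
    !![-(3 * l / 2), -(l / 2), 0, 0; l / 2, -(l / 2), 0, 0; a, a, -l, 0; b, b, 0, -l],
    !![l / 2, -(l / 2), 0, 0; l / 2, -(l / 2), 0, 0; a, a, -l, 0; b, b, 0, -l],
    !![-(l / 2), l / 2, 0, 0; l / 2, -(l / 2), 0, 0; a, b, -(l / 2), -(l / 2); b, a, -(l / 2), -(l / 2)],
    !![-(l / 2), l / 2, 0, 0; l / 2, -(l / 2), 0, 0; a, -b, -(l / 2), l / 2; b, -a, l / 2, -(l / 2)],
    !![-(3 * l / 2), -(l / 2), 0, 0; l / 2, -(l / 2), 0, 0; a, b, -(l / 2), -(l / 2); b, a, -(l / 2), -(l / 2)],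
    !![l / 2, -(l / 2), 0, 0; l / 2, -(l / 2), 0, 0; a, b, -(l / 2), -(l / 2); b, a, -(l / 2), -(l / 2)],
    !![-(3 * l / 2), -(l / 2), 0, 0; l / 2, -(l / 2), 0, 0; a, -b, -(l / 2), l / 2; b, -a, l / 2, -(l / 2)],
    !![l / 2, -(l / 2), 0, 0; l / 2, -(l / 2), 0, 0; a, -b, -(l / 2), l / 2; b, -a, l / 2, -(l / 2)],
    !![-(3 * l / 2), l / 2, 0, 0; -(l / 2), -(l / 2), 0, 0; a, a, 0, 0; b, b, 0, 0],
    !![l / 2, l / 2, 0, 0; -(l / 2), -(l / 2), 0, 0; a, a, 0, 0; b, b, 0, 0],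
    !![-(3 * l / 2), l / 2, 0, 0; -(l / 2), -(l / 2), 0, 0; a, -a, -l, 0; b, -b, 0, -l],
    !![l / 2, l / 2, 0, 0; -(l / 2), -(l / 2), 0, 0; a, -a, -l, 0; b, -b, 0, -l],
    !![-(l / 2), -(l / 2), 0, 0; -(l / 2), -(l / 2), 0, 0; a, a, 0, 0; b, b, 0, 0],
    !![-(l / 2), -(l / 2), 0, 0; -(l / 2), -(l / 2), 0, 0; a, -a, -l, 0; b, -b, 0, -l],
    !![-(l / 2), l / 2, 0, 0; l / 2, -(l / 2), 0, 0; a, -a, 0, 0; b, -b, 0, 0],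
    !![-(l / 2), l / 2, 0, 0; l / 2, -(l / 2), 0, 0; a, a, -l, 0; b, b, 0, -l] }

/-- The matrices of the classification with a parameter `a` in a denominator; they are used only
for `a ≠ 0`. -/
noncomputable def familiesOverA (l a b c : ℝ) : Set (Matrix (Fin 4) (Fin 4) ℝ) :=
  { !![0, -b, a, -a; 0, b, -a, a; 0, (b - c) * (b + l) / a, -b + c - l, b - c; 0, -(c * (b + l) / a), c, -c - l],
    !![0, -b, a, -a; 0, b, -a, a; 0, b * (b - c + l) / a, -b + c - l, b - c + l; 0, -(b * c / a), c, -c],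
    !![-l, -b - l, a, -a; 0, b, -a, a; 0, (b - c) * (b + l) / a, -b + c - l, b - c; 0, -(c * (b + l) / a), c, -c - l],
    !![-l, -b - l, a, -a; 0, b, -a, a; 0, b * (b - c + l) / a, -b + c - l, b - c + l; 0, -(b * c / a), c, -c],
    !![0, b, a, -a; 0, b, a, -a; 0, -((b - c) * (b + l) / a), -b + c - l, b - c; 0, c * (b + l) / a, c, -c - l],
    !![0, b, a, -a; 0, b, a, -a; 0, -(b * (b - c + l) / a), -b + c - l, b - c + l; 0, b * c / a, c, -c],
    !![-l, b + l, a, -a; 0, b, a, -a; 0, -((b - c) * (b + l) / a), -b + c - l, b - c; 0, c * (b + l) / a, c, -c - l],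
    !![-l, b + l, a, -a; 0, b, a, -a; 0, -(b * (b - c + l) / a), -b + c - l, b - c + l; 0, b * c / a, c, -c],
    !![0, -b, a, a; 0, b, -a, -a; 0, (b + c) * (b + l) / a, -b - c - l, -b - c; 0, -(c * (b + l) / a), c, c - l],
    !![0, -b, a, a; 0, b, -a, -a; 0, b * (b + c + l) / a, -b - c - l, -b - c - l; 0, -(b * c / a), c, c],
    !![-l, -b - l, a, a; 0, b, -a, -a; 0, (b + c) * (b + l) / a, -b - c - l, -b - c; 0, -(c * (b + l) / a), c, c - l],
    !![-l, -b - l, a, a; 0, b, -a, -a; 0, b * (b + c + l) / a, -b - c - l, -b - c - l; 0, -(b * c / a), c, c],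
    !![0, b, a, a; 0, b, a, a; 0, -((b + c) * (b + l) / a), -b - c - l, -b - c; 0, c * (b + l) / a, c, c - l],
    !![0, b, a, a; 0, b, a, a; 0, -(b * (b + c + l) / a), -b - c - l, -b - c - l; 0, b * c / a, c, c],
    !![-l, b + l, a, a; 0, b, a, a; 0, -((b + c) * (b + l) / a), -b - c - l, -b - c; 0, c * (b + l) / a, c, c - l],
    !![-l, b + l, a, a; 0, b, a, a; 0, -(b * (b + c + l) / a), -b - c - l, -b - c - l; 0, b * c / a, c, c] }

/-- The matrices of the classification with denominator `b + l`; they are used only for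
`b + l ≠ 0`. -/
noncomputable def familiesOverSum (l a b : ℝ) : Set (Matrix (Fin 4) (Fin 4) ℝ) :=
  { !![0, -l, 0, 0; 0, -l, 0, 0; 0, a, b, -b - l; 0, a * b / (b + l), b, -b - l],
    !![0, l, 0, 0; 0, -l, 0, 0; 0, a, b, -b - l; 0, a * b / (b + l), b, -b - l],
    !![-l, 0, 0, 0; 0, -l, 0, 0; 0, a, b, -b - l; 0, a * b / (b + l), b, -b - l],
    !![0, 0, 0, 0; 0, 0, 0, 0; 0, a, -b - l, -b - l; 0, -(a * b / (b + l)), b, b],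
    !![-l, -l, 0, 0; 0, 0, 0, 0; 0, a, -b - l, -b - l; 0, -(a * b / (b + l)), b, b],
    !![-l, l, 0, 0; 0, 0, 0, 0; 0, a, -b - l, -b - l; 0, -(a * b / (b + l)), b, b] }

/-- The matrices of the classification with denominator `l - b`; they are used only for
`l - b ≠ 0`. -/
noncomputable def familiesOverDiff (l a b : ℝ) : Set (Matrix (Fin 4) (Fin 4) ℝ) :=
  { !![0, -l, 0, 0; 0, -l, 0, 0; 0, a, -b, l - b; 0, a * b / (l - b), b, b - l],
    !![0, l, 0, 0; 0, -l, 0, 0; 0, a, -b, l - b; 0, a * b / (l - b), b, b - l],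
    !![-l, 0, 0, 0; 0, -l, 0, 0; 0, a, -b, l - b; 0, a * b / (l - b), b, b - l],
    !![0, 0, 0, 0; 0, 0, 0, 0; 0, a, b - l, l - b; 0, -(a * b / (l - b)), b, -b],
    !![-l, -l, 0, 0; 0, 0, 0, 0; 0, a, b - l, l - b; 0, -(a * b / (l - b)), b, -b],
    !![-l, l, 0, 0; 0, 0, 0, 0; 0, a, b - l, l - b; 0, -(a * b / (l - b)), b, -b] }

/-- `M` is one of the listed matrices for some values of the parameters at which the denominator
occurring in it does not vanish. -/
def IsListed (l : ℝ) (M : Matrix (Fin 4) (Fin 4) ℝ) : Prop :=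
  (∃ a b : ℝ, M ∈ polynomialFamilies l a b) ∨
  (∃ a b c : ℝ, a ≠ 0 ∧ M ∈ familiesOverA l a b c) ∨
  (∃ a b : ℝ, b + l ≠ 0 ∧ M ∈ familiesOverSum l a b) ∨
  (∃ a b : ℝ, l - b ≠ 0 ∧ M ∈ familiesOverDiff l a b)

namespace SplitSemiQuaternion

/-! Write `J` for the radical spanned by `e₂, e₃`. It has square zero, and the quotient by it is
`ℝ[e₁]/(e₁² - 1)`. Left multiplication by `e₁` acts on `J` as the swap `S` of `e₂` and `e₃`, right
multiplication as `-S`. Matrix rows are named `w, x, y, z`; subscripts are columns.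

Sufficiency is a coordinate check. For necessity, the identity on pairs from `J` shows that `P`
preserves `J` or maps it, modulo `J`, onto one line spanned by `1 + s e₁` with `s = ±1`
(`radical_coordinates`).

If `P` preserves `J`, the induced operator on the quotient is one of twelve (`quotient_cases`). Let
`B` be the block of `P` on `J`, and `b₀`, `b₁` the `J`-parts of `P(1)`, `P(e₁)`. Pairing `1` with
`J` on both sides gives `B² + lB = 0` and `x₀(SB - BS) = 0`; pairing `e₁` with `J` gives `x₁SB = (x₁
+ l)BS + BSB`. So for `x₀ = 0` the range of `B` (`x₁ = -l`) or its kernel (`x₁ = 0`) is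
`S`-invariant, while for `x₀ = ±l/2` the block commutes with `S`. The pairs `(1, 1)` and `(1, e₁)`
then determine or constrain `b₀` and `b₁`.

If `P` does not preserve `J`, commutators with `P(1)` force `P(1)` to be scalar, so `P² + lP = 0`,
and this is solved explicitly (`isListed_of_radical_ne_zero`). -/

/-- The operator with matrix `M` in coordinates. -/
theorem toLin_mk (M : Matrix (Fin 4) (Fin 4) ℝ) (a b c d : ℝ) :
    Matrix.toLin stdBasis stdBasis M (⟨a, b, c, d⟩ : SplitSemiQuaternion) =
      ⟨M 0 0 * a + M 0 1 * b + M 0 2 * c + M 0 3 * d,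
        M 1 0 * a + M 1 1 * b + M 1 2 * c + M 1 3 * d,
        M 2 0 * a + M 2 1 * b + M 2 2 * c + M 2 3 * d,
        M 3 0 * a + M 3 1 * b + M 3 2 * c + M 3 3 * d⟩ := by
  apply (QuaternionAlgebra.basisOneIJK (1 : ℝ) 0 0).repr.injective
  ext i
  change (stdBasis.repr _) i = _
  rw [← LinearMap.toMatrix_mulVec_repr stdBasis stdBasis, LinearMap.toMatrix_toLin]
  fin_cases i <;> simp [Matrix.mulVec, dotProduct, Fin.sum_univ_four]

theorem toLin_of_mk (w₀ w₁ w₂ w₃ x₀ x₁ x₂ x₃ y₀ y₁ y₂ y₃ z₀ z₁ z₂ z₃ a b c d : ℝ) :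
    Matrix.toLin stdBasis stdBasis
        !![w₀, w₁, w₂, w₃; x₀, x₁, x₂, x₃; y₀, y₁, y₂, y₃; z₀, z₁, z₂, z₃]
        (⟨a, b, c, d⟩ : SplitSemiQuaternion) =
      ⟨w₀ * a + w₁ * b + w₂ * c + w₃ * d, x₀ * a + x₁ * b + x₂ * c + x₃ * d,
        y₀ * a + y₁ * b + y₂ * c + y₃ * d, z₀ * a + z₁ * b + z₂ * c + z₃ * d⟩ :=
  toLin_mk _ _ _ _ _

/-- A four by four matrix is the array of its entries. -/
theorem matrix_eq_entries (M : Matrix (Fin 4) (Fin 4) ℝ) :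
    M = !![M 0 0, M 0 1, M 0 2, M 0 3; M 1 0, M 1 1, M 1 2, M 1 3;
      M 2 0, M 2 1, M 2 2, M 2 3; M 3 0, M 3 1, M 3 2, M 3 3] := by
  ext i j
  fin_cases i <;> fin_cases j <;> rfl

/-! ### Sufficiency: the listed matrices satisfy the identity. -/

set_option maxHeartbeats 4000000 in
theorem polynomialFamilies_isRotaBaxter {l a b : ℝ}
    {M : Matrix (Fin 4) (Fin 4) ℝ} (hM : M ∈ polynomialFamilies l a b) :
    IsRotaBaxter l (Matrix.toLin stdBasis stdBasis M) := by
  rintro ⟨a₀, a₁, a₂, a₃⟩ ⟨b₀, b₁, b₂, b₃⟩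
  simp only [polynomialFamilies, Set.mem_insert_iff, Set.mem_singleton_iff] at hM
  rcases hM with
    rfl | rfl | rfl | rfl | rfl | rfl | rfl | rfl | rfl | rfl | rfl | rfl | rfl | rfl | rfl |
    rfl | rfl | rfl | rfl | rfl | rfl | rfl | rfl | rfl | rfl | rfl | rfl | rfl | rfl | rfl |
    rfl | rfl | rfl | rfl | rfl | rfl | rfl | rfl | rfl | rfl | rfl | rfl | rfl | rfl | rfl |
    rfl | rfl | rfl | rfl | rfl | rfl | rfl <;>
  simp only [mk_mul_mk, toLin_of_mk, QuaternionAlgebra.mk_add_mk, QuaternionAlgebra.smul_mk,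
    smul_eq_mul, zero_mul, zero_add] <;>
  refine QuaternionAlgebra.ext ?_ ?_ ?_ ?_ <;> dsimp only <;> ring

set_option maxHeartbeats 4000000 in
theorem familiesOverA_isRotaBaxter {l a b c : ℝ} (ha : a ≠ 0)
    {M : Matrix (Fin 4) (Fin 4) ℝ} (hM : M ∈ familiesOverA l a b c) :
    IsRotaBaxter l (Matrix.toLin stdBasis stdBasis M) := by
  rintro ⟨a₀, a₁, a₂, a₃⟩ ⟨b₀, b₁, b₂, b₃⟩
  simp only [familiesOverA, Set.mem_insert_iff, Set.mem_singleton_iff] at hM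
  rcases hM with
    rfl | rfl | rfl | rfl | rfl | rfl | rfl | rfl | rfl | rfl | rfl | rfl | rfl | rfl | rfl |
    rfl <;>
  simp only [mk_mul_mk, toLin_of_mk, QuaternionAlgebra.mk_add_mk, QuaternionAlgebra.smul_mk,
    smul_eq_mul, zero_mul, zero_add] <;>
  refine QuaternionAlgebra.ext ?_ ?_ ?_ ?_ <;> dsimp only <;> (try field_simp) <;> ring

set_option maxHeartbeats 4000000 in
theorem familiesOverSum_isRotaBaxter {l a b : ℝ} (hb : b + l ≠ 0)
    {M : Matrix (Fin 4) (Fin 4) ℝ} (hM : M ∈ familiesOverSum l a b) :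
    IsRotaBaxter l (Matrix.toLin stdBasis stdBasis M) := by
  rintro ⟨a₀, a₁, a₂, a₃⟩ ⟨b₀, b₁, b₂, b₃⟩
  simp only [familiesOverSum, Set.mem_insert_iff, Set.mem_singleton_iff] at hM
  rcases hM with
    rfl | rfl | rfl | rfl | rfl | rfl <;>
  simp only [mk_mul_mk, toLin_of_mk, QuaternionAlgebra.mk_add_mk, QuaternionAlgebra.smul_mk,
    smul_eq_mul, zero_mul, mul_zero, zero_add, add_zero, sub_zero] <;>
  refine QuaternionAlgebra.ext ?_ ?_ ?_ ?_ <;> dsimp only <;> (try field_simp) <;> ring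

set_option maxHeartbeats 4000000 in
theorem familiesOverDiff_isRotaBaxter {l a b : ℝ} (hb : l - b ≠ 0)
    {M : Matrix (Fin 4) (Fin 4) ℝ} (hM : M ∈ familiesOverDiff l a b) :
    IsRotaBaxter l (Matrix.toLin stdBasis stdBasis M) := by
  rintro ⟨a₀, a₁, a₂, a₃⟩ ⟨b₀, b₁, b₂, b₃⟩
  simp only [familiesOverDiff, Set.mem_insert_iff, Set.mem_singleton_iff] at hM
  rcases hM with
    rfl | rfl | rfl | rfl | rfl | rfl <;>
  simp only [mk_mul_mk, toLin_of_mk, QuaternionAlgebra.mk_add_mk, QuaternionAlgebra.smul_mk,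
    smul_eq_mul, zero_mul, mul_zero, zero_add, add_zero, sub_zero] <;>
  refine QuaternionAlgebra.ext ?_ ?_ ?_ ?_ <;> dsimp only <;> (try field_simp) <;> ring

/-- Reduces matching with a listed matrix to sixteen scalar identities. -/
theorem matrix_congr {w₀ w₁ w₂ w₃ x₀ x₁ x₂ x₃ y₀ y₁ y₂ y₃ z₀ z₁ z₂ z₃ : ℝ}
    {w₀' w₁' w₂' w₃' x₀' x₁' x₂' x₃' y₀' y₁' y₂' y₃' z₀' z₁' z₂' z₃' : ℝ}
    (hw₀ : w₀ = w₀') (hw₁ : w₁ = w₁') (hw₂ : w₂ = w₂') (hw₃ : w₃ = w₃')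
    (hx₀ : x₀ = x₀') (hx₁ : x₁ = x₁') (hx₂ : x₂ = x₂') (hx₃ : x₃ = x₃')
    (hy₀ : y₀ = y₀') (hy₁ : y₁ = y₁') (hy₂ : y₂ = y₂') (hy₃ : y₃ = y₃')
    (hz₀ : z₀ = z₀') (hz₁ : z₁ = z₁') (hz₂ : z₂ = z₂') (hz₃ : z₃ = z₃') :
    !![w₀, w₁, w₂, w₃; x₀, x₁, x₂, x₃; y₀, y₁, y₂, y₃; z₀, z₁, z₂, z₃] =
      !![w₀', w₁', w₂', w₃'; x₀', x₁', x₂', x₃'; y₀', y₁', y₂', y₃'; z₀', z₁', z₂', z₃'] := by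
  subst_vars
  rfl

/-! ### Necessity: solving the scalar equations on the quotient and on the radical. -/

/-- The coordinates of the images of `e₂` and `e₃` modulo the radical. -/
theorem radical_coordinates {w₂ w₃ x₂ x₃ : ℝ} (h₂ : x₂ ^ 2 = w₂ ^ 2) (h₃ : x₃ ^ 2 = w₃ ^ 2)
    (h : x₂ ^ 2 = x₃ ^ 2) (h₂₃ : x₂ * x₃ = w₂ * w₃) (h' : x₂ * w₂ = x₃ * w₃) :
    (w₂ = 0 ∧ w₃ = 0 ∧ x₂ = 0 ∧ x₃ = 0) ∨
      (w₂ ≠ 0 ∧ ∃ s t : ℝ, (s = 1 ∨ s = -1) ∧ (t = 1 ∨ t = -1) ∧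
        x₂ = s * w₂ ∧ w₃ = t * w₂ ∧ x₃ = s * t * w₂) := by
  by_cases hw : w₂ = 0
  · left
    grind
  · have hs : x₂ = w₂ ∨ x₂ = -w₂ := sq_eq_sq_iff_eq_or_eq_neg.1 h₂
    have ht : w₃ = w₂ ∨ w₃ = -w₂ := sq_eq_sq_iff_eq_or_eq_neg.1 (by linarith)
    refine Or.inr ⟨hw, ?_⟩
    rcases hs with hs | hs <;> rcases ht with ht | ht
    · exact ⟨1, 1, by simp, by simp, by grind, by grind, by grind⟩
    · exact ⟨1, -1, by simp, by simp, by grind, by grind, by grind⟩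
    · exact ⟨-1, 1, by simp, by simp, by grind, by grind, by grind⟩
    · exact ⟨-1, -1, by simp, by simp, by grind, by grind, by grind⟩

/-- The Rota-Baxter operators of nonzero weight on the quotient by the radical. -/
theorem quotient_cases {l w₀ w₁ x₀ x₁ : ℝ} (hl : l ≠ 0)
    (h₀₀ : w₀ ^ 2 + x₀ ^ 2 = 2 * (w₀ ^ 2 + w₁ * x₀) + l * w₀)
    (h₀₀' : x₀ * (2 * x₁ + l) = 0)
    (h₀₁ : w₀ * w₁ + x₀ * x₁ = w₀ * (x₀ + w₁) + w₁ * (w₀ + x₁ + l))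
    (h₀₁' : w₀ * x₁ + x₀ * w₁ = x₀ * (x₀ + w₁) + x₁ * (w₀ + x₁ + l))
    (h₁₁ : w₁ ^ 2 + x₁ ^ 2 = w₀ * (2 * x₁ + l) + w₁ * (2 * w₁)) :
    (x₀ = 0 ∧ x₁ = -l ∧ ((w₀ = 0 ∧ w₁ = -l) ∨ (w₀ = 0 ∧ w₁ = l) ∨ (w₀ = -l ∧ w₁ = 0))) ∨
    (x₀ = 0 ∧ x₁ = 0 ∧ ((w₀ = 0 ∧ w₁ = 0) ∨ (w₀ = -l ∧ w₁ = -l) ∨ (w₀ = -l ∧ w₁ = l))) ∨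
    (x₀ = -(l / 2) ∧ x₁ = -(l / 2) ∧ ((w₀ = -(3 * l / 2) ∧ w₁ = l / 2) ∨
      (w₀ = l / 2 ∧ w₁ = l / 2) ∨ (w₀ = -(l / 2) ∧ w₁ = -(l / 2)))) ∨
    (x₀ = l / 2 ∧ x₁ = -(l / 2) ∧ ((w₀ = -(3 * l / 2) ∧ w₁ = -(l / 2)) ∨
      (w₀ = l / 2 ∧ w₁ = -(l / 2)) ∨ (w₀ = -(l / 2) ∧ w₁ = l / 2))) := by
  rcases mul_eq_zero.1 h₀₀' with hx₀ | hx₁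
  · subst hx₀
    have hx : x₁ * (x₁ + l) = 0 := by linear_combination -h₀₁'
    rcases mul_eq_zero.1 hx with hx₁ | hx₁
    · have hw : w₀ * (w₀ + l) = 0 := by linear_combination -h₀₀
      refine Or.inr (Or.inl ⟨rfl, hx₁, ?_⟩)
      rcases mul_eq_zero.1 hw with hw | hw <;> grind
    · have hw : w₀ * (w₀ + l) = 0 := by linear_combination -h₀₀
      refine Or.inl ⟨rfl, by linarith, ?_⟩
      rcases mul_eq_zero.1 hw with hw | hw <;> grind
  · have hx₁ : x₁ = -(l / 2) := by linarith
    subst hx₁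
    have hx : (x₀ + l / 2) * (x₀ - l / 2) = 0 := by linear_combination -h₀₁'
    have hw : (w₁ + l / 2) * (w₁ - l / 2) = 0 := by linear_combination -h₁₁
    -- If `w₁ = x₀`, then `h₀₁` is linear in `w₀` and fixes it. If `w₁ = -x₀`, then `h₀₁` is vacuous
    -- and `h₀₀` is a quadratic with roots `-3l/2` and `l/2`.
    rcases mul_eq_zero.1 hx with hx | hx <;> rcases mul_eq_zero.1 hw with hw | hw
    · have : w₀ = -(l / 2) := by apply mul_left_cancel₀ hl; grind
      grind
    · have : (w₀ + 3 * l / 2) * (w₀ - l / 2) = 0 := by grind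
      rcases mul_eq_zero.1 this with h | h <;> grind
    · have : (w₀ + 3 * l / 2) * (w₀ - l / 2) = 0 := by grind
      rcases mul_eq_zero.1 this with h | h <;> grind
    · have : w₀ = -(l / 2) := by apply mul_left_cancel₀ hl; grind
      grind

/-- The entries, in the eigenbasis of the swap, of a block whose range is invariant under it. -/
theorem quasi_idempotent_cases {l p q r s : ℝ} (hl : l ≠ 0) (hp : p * (p + l) = 0)
    (hs : s * (s + l) = 0) (hpq : (p + l) * q = 0) (hpr : r * p = 0) (hqs : q * s = 0)
    (hrs : (s + l) * r = 0) :
    (p = 0 ∧ q = 0 ∧ r = 0 ∧ s = 0) ∨ (p = -l ∧ q = 0 ∧ r = 0 ∧ s = -l) ∨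
      (p = -l ∧ r = 0 ∧ s = 0) ∨ (p = 0 ∧ q = 0 ∧ s = -l) := by
  rcases mul_eq_zero.1 hp with hp | hp <;> rcases mul_eq_zero.1 hs with hs | hs
  · grind
  · grind
  · grind
  · grind

/-- The block on the radical when its range is invariant under the swap of `e₂` and `e₃`. -/
theorem block_cases_of_range {l y₂ y₃ z₂ z₃ : ℝ} (hl : l ≠ 0)
    (h₁ : y₂ * y₂ + y₃ * z₂ + l * y₂ = 0) (h₂ : y₂ * y₃ + y₃ * z₃ + l * y₃ = 0)
    (h₃ : z₂ * y₂ + z₃ * z₂ + l * z₂ = 0) (h₄ : z₂ * y₃ + z₃ * z₃ + l * z₃ = 0)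
    (h₅ : (y₂ + l) * z₂ + y₃ * y₂ = 0) (h₆ : (y₂ + l) * z₃ + y₃ * y₃ = 0)
    (h₇ : z₂ * z₂ + (z₃ + l) * y₂ = 0) (h₈ : z₂ * z₃ + (z₃ + l) * y₃ = 0) :
    (y₂ = 0 ∧ y₃ = 0 ∧ z₂ = 0 ∧ z₃ = 0) ∨ (y₂ = -l ∧ y₃ = 0 ∧ z₂ = 0 ∧ z₃ = -l) ∨
      (z₂ = y₂ ∧ y₃ = -y₂ - l ∧ z₃ = -y₂ - l) ∨ (y₂ = -z₂ ∧ y₃ = l - z₂ ∧ z₃ = z₂ - l) := by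
  -- The hypotheses are the entries of `(B + l)B = 0` and `(B + l)SB = 0`. In the basis `e₂ + e₃, e₂
  -- - e₃` the block is `[p, q; r, s]`, and its `S`-invariant range is zero, everything, or one of
  -- the two eigenlines.
  have := quasi_idempotent_cases (l := l) (p := (y₂ + y₃ + z₂ + z₃) / 2)
    (q := (y₂ - y₃ + z₂ - z₃) / 2) (r := (y₂ + y₃ - z₂ - z₃) / 2) (s := (y₂ - y₃ - z₂ + z₃) / 2) hl
    (by linear_combination (h₁ + h₂ + h₃ + h₄ + h₅ + h₆ + h₇ + h₈) / 4)
    (by linear_combination (h₁ - h₂ - h₃ + h₄ - h₅ + h₆ + h₇ - h₈) / 4)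
    (by linear_combination (h₁ - h₂ + h₃ - h₄ + h₅ - h₆ + h₇ - h₈) / 4)
    (by linear_combination (h₁ + h₂ - h₃ - h₄ + h₅ + h₆ - h₇ - h₈) / 4)
    (by linear_combination (h₁ - h₂ + h₃ - h₄ - h₅ + h₆ - h₇ + h₈) / 4)
    (by linear_combination (h₁ + h₂ - h₃ - h₄ - h₅ - h₆ + h₇ + h₈) / 4)
  rcases this with h | h | h | h
  · left; grind
  · right; left; grind
  · right; right; left; grind
  · right; right; right; grind

/-- The block on the radical when its kernel is invariant under the swap of `e₂` and `e₃`. -/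
theorem block_cases_of_ker {l y₂ y₃ z₂ z₃ : ℝ} (hl : l ≠ 0)
    (h₁ : y₂ * y₂ + y₃ * z₂ + l * y₂ = 0) (h₂ : y₂ * y₃ + y₃ * z₃ + l * y₃ = 0)
    (h₃ : z₂ * y₂ + z₃ * z₂ + l * z₂ = 0) (h₄ : z₂ * y₃ + z₃ * z₃ + l * z₃ = 0)
    (h₅ : y₃ * (y₂ + l) + y₂ * z₂ = 0) (h₆ : y₃ * y₃ + y₂ * (z₃ + l) = 0)
    (h₇ : z₃ * (y₂ + l) + z₂ * z₂ = 0) :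
    (y₂ = 0 ∧ y₃ = 0 ∧ z₂ = 0 ∧ z₃ = 0) ∨ (y₂ = -l ∧ y₃ = 0 ∧ z₂ = 0 ∧ z₃ = -l) ∨
      (y₂ = -z₂ - l ∧ y₃ = -z₂ - l ∧ z₃ = z₂) ∨ (y₂ = z₂ - l ∧ y₃ = l - z₂ ∧ z₃ = -z₂) := by
  -- Transposition turns `BS(B + l) = 0` into the range condition. The one entry not assumed is `h₂
  -- + h₃ - h₅`.
  rcases block_cases_of_range (y₂ := y₂) (y₃ := z₂) (z₂ := y₃) (z₃ := z₃) hl (by linarith)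
    (by linarith) (by linarith) (by linarith) (by linarith) (by linarith) (by linarith)
    (by linarith) with h | h | h | h
  · left; grind
  · right; left; grind
  · right; right; left; grind
  · right; right; right; grind

/-- The block on the radical when it commutes with the swap of `e₂` and `e₃`. -/
theorem block_cases_of_commute {l y z : ℝ} (h₁ : y * y + z * z + l * y = 0)
    (h₂ : 2 * y * z + l * z = 0) :
    (y = 0 ∧ z = 0) ∨ (y = -l ∧ z = 0) ∨ (y = -(l / 2) ∧ z = -(l / 2)) ∨
      (y = -(l / 2) ∧ z = l / 2) := by
  -- The block `y + zS` has eigenvalues `y ± z` on `e₂ ± e₃`, each `0` or `-l`: hence four cases.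
  have h : z * (2 * y + l) = 0 := by linarith
  rcases mul_eq_zero.1 h with h | h
  · have : y * (y + l) = 0 := by grind
    rcases mul_eq_zero.1 this with h | h <;> grind
  · have : (z - l / 2) * (z + l / 2) = 0 := by grind
    rcases mul_eq_zero.1 this with h | h <;> grind

/-! ### Matching the solutions with the list. -/

/-- Operators preserving the radical, with `P(e₁)` congruent to `w₁ - l e₁` and `P(1)` scalar. -/
theorem isListed_of_range {l w₀ w₁ y₁ y₂ y₃ z₁ z₂ z₃ : ℝ} (hl : l ≠ 0)
    (hw : (w₀ = 0 ∧ w₁ = -l) ∨ (w₀ = 0 ∧ w₁ = l) ∨ (w₀ = -l ∧ w₁ = 0))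
    (h₁ : y₂ * y₂ + y₃ * z₂ + l * y₂ = 0) (h₂ : y₂ * y₃ + y₃ * z₃ + l * y₃ = 0)
    (h₃ : z₂ * y₂ + z₃ * z₂ + l * z₂ = 0) (h₄ : z₂ * y₃ + z₃ * z₃ + l * z₃ = 0)
    (h₅ : (y₂ + l) * z₂ + y₃ * y₂ = 0) (h₆ : (y₂ + l) * z₃ + y₃ * y₃ = 0)
    (h₇ : z₂ * z₂ + (z₃ + l) * y₂ = 0) (h₈ : z₂ * z₃ + (z₃ + l) * y₃ = 0)
    (hy : y₂ * y₁ + y₃ * z₁ = 0) (hz : z₂ * y₁ + z₃ * z₁ = 0) :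
    IsListed l !![w₀, w₁, 0, 0; 0, -l, 0, 0; 0, y₁, y₂, y₃; 0, z₁, z₂, z₃] := by
  rcases block_cases_of_range hl h₁ h₂ h₃ h₄ h₅ h₆ h₇ h₈ with
    ⟨hy₂, hy₃, hz₂, hz₃⟩ | ⟨hy₂, hy₃, hz₂, hz₃⟩ | ⟨hz₂, hy₃, hz₃⟩ | ⟨hy₂, hy₃, hz₃⟩
  · refine Or.inl ⟨y₁, z₁, ?_⟩
    rcases hw with ⟨hw₀, hw₁⟩ | ⟨hw₀, hw₁⟩ | ⟨hw₀, hw₁⟩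
    -- Here and below, the number of `Or.inr` steps within a family is the zero-based position of
    -- the matrix in it.
    on_goal 2 => refine Or.inr ?_
    on_goal 3 => iterate 2 refine Or.inr ?_
    all_goals exact Or.inl (by apply matrix_congr <;> linarith)
  · have hy₁ : y₁ = 0 := by grind
    have hz₁ : z₁ = 0 := by grind
    refine Or.inl ⟨0, 0, ?_⟩
    rcases hw with ⟨hw₀, hw₁⟩ | ⟨hw₀, hw₁⟩ | ⟨hw₀, hw₁⟩
    on_goal 1 => iterate 22 refine Or.inr ?_
    on_goal 2 => iterate 23 refine Or.inr ?_
    on_goal 3 => iterate 19 refine Or.inr ?_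
    all_goals exact Or.inl (by apply matrix_congr <;> linarith)
  -- The kernel condition reads `y₂ y₁ = (y₂ + l) z₁`. It gives `z₁` unless `y₂ = -l`; then `y₁ =
  -- 0`, `z₁` is free, and the matrix is a polynomial one.
  · by_cases hb : y₂ + l = 0
    · have hy₁ : y₁ = 0 := by grind
      refine Or.inl ⟨z₁, 0, ?_⟩
      rcases hw with ⟨hw₀, hw₁⟩ | ⟨hw₀, hw₁⟩ | ⟨hw₀, hw₁⟩
      on_goal 1 => iterate 6 refine Or.inr ?_
      on_goal 2 => iterate 7 refine Or.inr ?_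
      on_goal 3 => iterate 10 refine Or.inr ?_
      all_goals exact Or.inl (by apply matrix_congr <;> linarith)
    · have hz₁ : z₁ = y₁ * y₂ / (y₂ + l) := by rw [eq_div_iff hb]; grind
      refine Or.inr (Or.inr (Or.inl ⟨y₁, y₂, hb, ?_⟩))
      rcases hw with ⟨hw₀, hw₁⟩ | ⟨hw₀, hw₁⟩ | ⟨hw₀, hw₁⟩
      on_goal 2 => refine Or.inr ?_
      on_goal 3 => iterate 2 refine Or.inr ?_
      all_goals exact Or.inl (by apply matrix_congr <;> linarith)
  · by_cases hb : l - z₂ = 0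
    · have hy₁ : y₁ = 0 := by grind
      refine Or.inl ⟨z₁, 0, ?_⟩
      rcases hw with ⟨hw₀, hw₁⟩ | ⟨hw₀, hw₁⟩ | ⟨hw₀, hw₁⟩
      on_goal 1 => iterate 8 refine Or.inr ?_
      on_goal 2 => iterate 9 refine Or.inr ?_
      on_goal 3 => iterate 11 refine Or.inr ?_
      all_goals exact Or.inl (by apply matrix_congr <;> linarith)
    · have hz₁ : z₁ = y₁ * z₂ / (l - z₂) := by rw [eq_div_iff hb]; grind
      refine Or.inr (Or.inr (Or.inr ⟨y₁, z₂, hb, ?_⟩))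
      rcases hw with ⟨hw₀, hw₁⟩ | ⟨hw₀, hw₁⟩ | ⟨hw₀, hw₁⟩
      on_goal 2 => refine Or.inr ?_
      on_goal 3 => iterate 2 refine Or.inr ?_
      all_goals exact Or.inl (by apply matrix_congr <;> linarith)

/-- Operators preserving the radical, with `P(1)` and `P(e₁)` scalar modulo the radical. -/
theorem isListed_of_ker {l w₀ w₁ y₁ y₂ y₃ z₁ z₂ z₃ : ℝ} (hl : l ≠ 0)
    (hw : (w₀ = 0 ∧ w₁ = 0) ∨ (w₀ = -l ∧ w₁ = -l) ∨ (w₀ = -l ∧ w₁ = l))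
    (h₁ : y₂ * y₂ + y₃ * z₂ + l * y₂ = 0) (h₂ : y₂ * y₃ + y₃ * z₃ + l * y₃ = 0)
    (h₃ : z₂ * y₂ + z₃ * z₂ + l * z₂ = 0) (h₄ : z₂ * y₃ + z₃ * z₃ + l * z₃ = 0)
    (h₅ : y₃ * (y₂ + l) + y₂ * z₂ = 0) (h₆ : y₃ * y₃ + y₂ * (z₃ + l) = 0)
    (h₇ : z₃ * (y₂ + l) + z₂ * z₂ = 0)
    (hy : y₂ * y₁ + y₃ * z₁ + l * y₁ = 0) (hz : z₂ * y₁ + z₃ * z₁ + l * z₁ = 0) :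
    IsListed l !![w₀, w₁, 0, 0; 0, 0, 0, 0; 0, y₁, y₂, y₃; 0, z₁, z₂, z₃] := by
  rcases block_cases_of_ker hl h₁ h₂ h₃ h₄ h₅ h₆ h₇ with
    ⟨hy₂, hy₃, hz₂, hz₃⟩ | ⟨hy₂, hy₃, hz₂, hz₃⟩ | ⟨hy₂, hy₃, hz₃⟩ | ⟨hy₂, hy₃, hz₃⟩
  · have hy₁ : y₁ = 0 := by grind
    have hz₁ : z₁ = 0 := by grind
    refine Or.inl ⟨0, 0, ?_⟩
    rcases hw with ⟨hw₀, hw₁⟩ | ⟨hw₀, hw₁⟩ | ⟨hw₀, hw₁⟩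
    on_goal 1 => iterate 18 refine Or.inr ?_
    on_goal 2 => iterate 20 refine Or.inr ?_
    on_goal 3 => iterate 21 refine Or.inr ?_
    all_goals exact Or.inl (by apply matrix_congr <;> linarith)
  · refine Or.inl ⟨y₁, z₁, ?_⟩
    rcases hw with ⟨hw₀, hw₁⟩ | ⟨hw₀, hw₁⟩ | ⟨hw₀, hw₁⟩
    on_goal 1 => iterate 3 refine Or.inr ?_
    on_goal 2 => iterate 4 refine Or.inr ?_
    on_goal 3 => iterate 5 refine Or.inr ?_
    all_goals exact Or.inl (by apply matrix_congr <;> linarith)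
  · by_cases hb : z₂ + l = 0
    · have hy₁ : y₁ = 0 := by grind
      refine Or.inl ⟨z₁, 0, ?_⟩
      rcases hw with ⟨hw₀, hw₁⟩ | ⟨hw₀, hw₁⟩ | ⟨hw₀, hw₁⟩
      on_goal 1 => iterate 12 refine Or.inr ?_
      on_goal 2 => iterate 14 refine Or.inr ?_
      on_goal 3 => iterate 15 refine Or.inr ?_
      all_goals exact Or.inl (by apply matrix_congr <;> linarith)
    · have hz₁ : z₁ = -(y₁ * z₂ / (z₂ + l)) := by rw [← neg_div, eq_div_iff hb]; grind
      refine Or.inr (Or.inr (Or.inl ⟨y₁, z₂, hb, ?_⟩))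
      rcases hw with ⟨hw₀, hw₁⟩ | ⟨hw₀, hw₁⟩ | ⟨hw₀, hw₁⟩
      on_goal 1 => iterate 3 refine Or.inr ?_
      on_goal 2 => iterate 4 refine Or.inr ?_
      -- The last matrix of a family is a singleton membership, with no `Or.inl` to take.
      on_goal 3 =>
        iterate 5 refine Or.inr ?_
        apply matrix_congr <;> linarith
      all_goals exact Or.inl (by apply matrix_congr <;> linarith)
  · by_cases hb : l - z₂ = 0
    · have hy₁ : y₁ = 0 := by grind
      refine Or.inl ⟨z₁, 0, ?_⟩
      rcases hw with ⟨hw₀, hw₁⟩ | ⟨hw₀, hw₁⟩ | ⟨hw₀, hw₁⟩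
      on_goal 1 => iterate 13 refine Or.inr ?_
      on_goal 2 => iterate 16 refine Or.inr ?_
      on_goal 3 => iterate 17 refine Or.inr ?_
      all_goals exact Or.inl (by apply matrix_congr <;> linarith)
    · have hz₁ : z₁ = -(y₁ * z₂ / (l - z₂)) := by rw [← neg_div, eq_div_iff hb]; grind
      refine Or.inr (Or.inr (Or.inr ⟨y₁, z₂, hb, ?_⟩))
      rcases hw with ⟨hw₀, hw₁⟩ | ⟨hw₀, hw₁⟩ | ⟨hw₀, hw₁⟩
      on_goal 1 => iterate 3 refine Or.inr ?_
      on_goal 2 => iterate 4 refine Or.inr ?_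
      on_goal 3 =>
        iterate 5 refine Or.inr ?_
        apply matrix_congr <;> linarith
      all_goals exact Or.inl (by apply matrix_congr <;> linarith)

set_option maxHeartbeats 1000000 in
/-- Operators preserving the radical, with `P(1)` congruent to `w₀ - (l / 2) e₁`. -/
theorem isListed_of_commute_neg {l w₀ w₁ y₀ y₁ y z₀ z₁ z : ℝ} (hl : l ≠ 0)
    (hw : (w₀ = -(3 * l / 2) ∧ w₁ = l / 2) ∨ (w₀ = l / 2 ∧ w₁ = l / 2) ∨
      (w₀ = -(l / 2) ∧ w₁ = -(l / 2)))
    (h₁ : y * y + z * z + l * y = 0) (h₂ : 2 * y * z + l * z = 0)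
    (hy : l * y₁ = (2 * y + l) * y₀ + 2 * z * z₀) (hz : l * z₁ = (2 * y + l) * z₀ + 2 * z * y₀) :
    IsListed l !![w₀, w₁, 0, 0; -(l / 2), -(l / 2), 0, 0; y₀, y₁, y, z; z₀, z₁, z, y] := by
  -- The hypotheses `hy`, `hz` say `l b₁ = (2B + l) b₀`, and in the four cases `2B + l` is `l`,
  -- `-l`, `-lS`, `lS`. Of repeated matrices the first copy is used.
  rcases block_cases_of_commute h₁ h₂ with ⟨hy', hz'⟩ | ⟨hy', hz'⟩ | ⟨hy', hz'⟩ | ⟨hy', hz'⟩ <;>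
    subst hy' hz'
  · have hy₁ : y₁ = y₀ := mul_left_cancel₀ hl (by linarith)
    have hz₁ : z₁ = z₀ := mul_left_cancel₀ hl (by linarith)
    refine Or.inl ⟨y₀, z₀, ?_⟩
    rcases hw with ⟨hw₀, hw₁⟩ | ⟨hw₀, hw₁⟩ | ⟨hw₀, hw₁⟩
    on_goal 1 => iterate 24 refine Or.inr ?_
    on_goal 2 => iterate 25 refine Or.inr ?_
    on_goal 3 => iterate 48 refine Or.inr ?_
    all_goals exact Or.inl (by apply matrix_congr <;> linarith)
  · have hy₁ : y₁ = -y₀ := mul_left_cancel₀ hl (by linarith)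
    have hz₁ : z₁ = -z₀ := mul_left_cancel₀ hl (by linarith)
    refine Or.inl ⟨y₀, z₀, ?_⟩
    rcases hw with ⟨hw₀, hw₁⟩ | ⟨hw₀, hw₁⟩ | ⟨hw₀, hw₁⟩
    on_goal 1 => iterate 26 refine Or.inr ?_
    on_goal 2 => iterate 27 refine Or.inr ?_
    on_goal 3 => iterate 49 refine Or.inr ?_
    all_goals exact Or.inl (by apply matrix_congr <;> linarith)
  · have hy₁ : y₁ = -z₀ := mul_left_cancel₀ hl (by linarith)
    have hz₁ : z₁ = -y₀ := mul_left_cancel₀ hl (by linarith)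
    refine Or.inl ⟨y₀, z₀, ?_⟩
    rcases hw with ⟨hw₀, hw₁⟩ | ⟨hw₀, hw₁⟩ | ⟨hw₀, hw₁⟩
    on_goal 1 => iterate 30 refine Or.inr ?_
    on_goal 2 => iterate 31 refine Or.inr ?_
    on_goal 3 => iterate 28 refine Or.inr ?_
    all_goals exact Or.inl (by apply matrix_congr <;> linarith)
  · have hy₁ : y₁ = z₀ := mul_left_cancel₀ hl (by linarith)
    have hz₁ : z₁ = y₀ := mul_left_cancel₀ hl (by linarith)
    refine Or.inl ⟨y₀, z₀, ?_⟩
    rcases hw with ⟨hw₀, hw₁⟩ | ⟨hw₀, hw₁⟩ | ⟨hw₀, hw₁⟩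
    on_goal 1 => iterate 32 refine Or.inr ?_
    on_goal 2 => iterate 33 refine Or.inr ?_
    on_goal 3 => iterate 29 refine Or.inr ?_
    all_goals exact Or.inl (by apply matrix_congr <;> linarith)

set_option maxHeartbeats 1000000 in
/-- Operators preserving the radical, with `P(1)` congruent to `w₀ + (l / 2) e₁`. -/
theorem isListed_of_commute_pos {l w₀ w₁ y₀ y₁ y z₀ z₁ z : ℝ} (hl : l ≠ 0)
    (hw : (w₀ = -(3 * l / 2) ∧ w₁ = -(l / 2)) ∨ (w₀ = l / 2 ∧ w₁ = -(l / 2)) ∨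
      (w₀ = -(l / 2) ∧ w₁ = l / 2))
    (h₁ : y * y + z * z + l * y = 0) (h₂ : 2 * y * z + l * z = 0)
    (hy : l * y₁ = -((2 * y + l) * y₀ + 2 * z * z₀)) (hz : l * z₁ = -((2 * y + l) * z₀ + 2 * z * y₀)) :
    IsListed l !![w₀, w₁, 0, 0; l / 2, -(l / 2), 0, 0; y₀, y₁, y, z; z₀, z₁, z, y] := by
  rcases block_cases_of_commute h₁ h₂ with ⟨hy', hz'⟩ | ⟨hy', hz'⟩ | ⟨hy', hz'⟩ | ⟨hy', hz'⟩ <;>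
    subst hy' hz'
  · have hy₁ : y₁ = -y₀ := mul_left_cancel₀ hl (by linarith)
    have hz₁ : z₁ = -z₀ := mul_left_cancel₀ hl (by linarith)
    refine Or.inl ⟨y₀, z₀, ?_⟩
    rcases hw with ⟨hw₀, hw₁⟩ | ⟨hw₀, hw₁⟩ | ⟨hw₀, hw₁⟩
    on_goal 1 => iterate 34 refine Or.inr ?_
    on_goal 2 => iterate 35 refine Or.inr ?_
    on_goal 3 => iterate 50 refine Or.inr ?_
    all_goals exact Or.inl (by apply matrix_congr <;> linarith)
  · have hy₁ : y₁ = y₀ := mul_left_cancel₀ hl (by linarith)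
    have hz₁ : z₁ = z₀ := mul_left_cancel₀ hl (by linarith)
    refine Or.inl ⟨y₀, z₀, ?_⟩
    rcases hw with ⟨hw₀, hw₁⟩ | ⟨hw₀, hw₁⟩ | ⟨hw₀, hw₁⟩
    on_goal 1 => iterate 36 refine Or.inr ?_
    on_goal 2 => iterate 37 refine Or.inr ?_
    on_goal 3 =>
      iterate 51 refine Or.inr ?_
      apply matrix_congr <;> linarith
    all_goals exact Or.inl (by apply matrix_congr <;> linarith)
  · have hy₁ : y₁ = z₀ := mul_left_cancel₀ hl (by linarith)
    have hz₁ : z₁ = y₀ := mul_left_cancel₀ hl (by linarith)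
    refine Or.inl ⟨y₀, z₀, ?_⟩
    rcases hw with ⟨hw₀, hw₁⟩ | ⟨hw₀, hw₁⟩ | ⟨hw₀, hw₁⟩
    on_goal 1 => iterate 40 refine Or.inr ?_
    on_goal 2 => iterate 41 refine Or.inr ?_
    on_goal 3 => iterate 38 refine Or.inr ?_
    all_goals exact Or.inl (by apply matrix_congr <;> linarith)
  · have hy₁ : y₁ = -z₀ := mul_left_cancel₀ hl (by linarith)
    have hz₁ : z₁ = -y₀ := mul_left_cancel₀ hl (by linarith)
    refine Or.inl ⟨y₀, z₀, ?_⟩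
    rcases hw with ⟨hw₀, hw₁⟩ | ⟨hw₀, hw₁⟩ | ⟨hw₀, hw₁⟩
    on_goal 1 => iterate 42 refine Or.inr ?_
    on_goal 2 => iterate 43 refine Or.inr ?_
    on_goal 3 => iterate 39 refine Or.inr ?_
    all_goals exact Or.inl (by apply matrix_congr <;> linarith)

/-- Operators not preserving the radical. -/
theorem isListed_of_radical_ne_zero {l a b c s t w₀ w₁ y₁ y₂ y₃ z₁ z₃ : ℝ} (ha : a ≠ 0)
    (hs : s = 1 ∨ s = -1) (ht : t = 1 ∨ t = -1) (hw₀ : w₀ = 0 ∨ w₀ = -l)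
    (hw₁ : w₁ = s * (b - w₀)) (hy₂ : y₂ = -b - l - t * c) (hy₃ : y₃ = -t * (b + l) - t * z₃)
    (hy₁ : s * (a * y₁) = -(y₂ * (y₂ + l) + y₃ * c)) (hz₁ : s * (a * z₁) = -(c * (y₂ + z₃ + l)))
    (hz₃ : (z₃ - t * c) * (z₃ - t * c + l) = 0) :
    IsListed l !![w₀, w₁, a, t * a; 0, b, s * a, s * t * a; 0, y₁, y₂, y₃; 0, z₁, c, z₃] := by
  have hs' : s * s = 1 := by rcases hs with rfl | rfl <;> norm_num
  have hy₁ : y₁ = -(s * (y₂ * (y₂ + l) + y₃ * c) / a) := by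
    rw [← neg_div, eq_div_iff ha]
    linear_combination s * hy₁ - a * y₁ * hs'
  have hz₁ : z₁ = -(s * (c * (y₂ + z₃ + l)) / a) := by
    rw [← neg_div, eq_div_iff ha]
    linear_combination s * hz₁ - a * z₁ * hs'
  -- By `hy₂` and `hy₃`, the vector `e₃ - t e₂` is an eigenvector with eigenvalue `z₃ - t c`; its
  -- two values split each sign pattern.
  have hz₃ : z₃ = t * c - l ∨ z₃ = t * c := by
    rcases mul_eq_zero.1 hz₃ with h | h
    · exact Or.inr (by linarith)
    · exact Or.inl (by linarith)
  rcases ht with rfl | rfl <;> rcases hs with rfl | rfl <;> rcases hw₀ with rfl | rfl <;>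
    rcases hz₃ with rfl | rfl <;> subst hy₃ hy₂ hw₁ hy₁ hz₁ <;>
    refine Or.inr (Or.inl ⟨a, b, c, ha, ?_⟩)
  on_goal 1 => iterate 12 refine Or.inr ?_
  on_goal 2 => iterate 13 refine Or.inr ?_
  on_goal 3 => iterate 14 refine Or.inr ?_
  on_goal 4 =>
    iterate 15 refine Or.inr ?_
    apply matrix_congr <;> ring
  -- The previous goal 4 is closed, so later numbers drop by one. Goal 12 is the head of the list
  -- and needs no shift.
  on_goal 4 => iterate 8 refine Or.inr ?_
  on_goal 5 => iterate 9 refine Or.inr ?_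
  on_goal 6 => iterate 10 refine Or.inr ?_
  on_goal 7 => iterate 11 refine Or.inr ?_
  on_goal 8 => iterate 4 refine Or.inr ?_
  on_goal 9 => iterate 5 refine Or.inr ?_
  on_goal 10 => iterate 6 refine Or.inr ?_
  on_goal 11 => iterate 7 refine Or.inr ?_
  on_goal 13 => refine Or.inr ?_
  on_goal 14 => iterate 2 refine Or.inr ?_
  on_goal 15 => iterate 3 refine Or.inr ?_
  all_goals exact Or.inl (by apply matrix_congr <;> ring)


/-! ### Necessity: extracting the equations from basis pairs. -/

set_option maxHeartbeats 2000000 in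
/-- The matrix of a Rota-Baxter operator of nonzero weight is listed. -/
theorem isListed_of_isRotaBaxter {l w₀ w₁ w₂ w₃ x₀ x₁ x₂ x₃ y₀ y₁ y₂ y₃ z₀ z₁ z₂ z₃ : ℝ}
    (hl : l ≠ 0)
    (h : IsRotaBaxter l (Matrix.toLin stdBasis stdBasis
      !![w₀, w₁, w₂, w₃; x₀, x₁, x₂, x₃; y₀, y₁, y₂, y₃; z₀, z₁, z₂, z₃])) :
    IsListed l !![w₀, w₁, w₂, w₃; x₀, x₁, x₂, x₃; y₀, y₁, y₂, y₃; z₀, z₁, z₂, z₃] := by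
  have h₀₀ := h ⟨1, 0, 0, 0⟩ ⟨1, 0, 0, 0⟩
  have h₀₁ := h ⟨1, 0, 0, 0⟩ ⟨0, 1, 0, 0⟩
  have h₁₁ := h ⟨0, 1, 0, 0⟩ ⟨0, 1, 0, 0⟩
  have h₀₂ := h ⟨1, 0, 0, 0⟩ ⟨0, 0, 1, 0⟩
  have h₂₀ := h ⟨0, 0, 1, 0⟩ ⟨1, 0, 0, 0⟩
  have h₀₃ := h ⟨1, 0, 0, 0⟩ ⟨0, 0, 0, 1⟩
  have h₁₂ := h ⟨0, 1, 0, 0⟩ ⟨0, 0, 1, 0⟩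
  have h₁₃ := h ⟨0, 1, 0, 0⟩ ⟨0, 0, 0, 1⟩
  have h₂₂ := h ⟨0, 0, 1, 0⟩ ⟨0, 0, 1, 0⟩
  have h₂₃ := h ⟨0, 0, 1, 0⟩ ⟨0, 0, 0, 1⟩
  have h₃₂ := h ⟨0, 0, 0, 1⟩ ⟨0, 0, 1, 0⟩
  have h₃₃ := h ⟨0, 0, 0, 1⟩ ⟨0, 0, 0, 1⟩
  simp only [toLin_of_mk, mk_mul_mk, QuaternionAlgebra.mk_add_mk, QuaternionAlgebra.smul_mk,
    QuaternionAlgebra.mk.injEq, smul_eq_mul, mul_zero, mul_one, zero_mul, one_mul, add_zero,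
    zero_add, sub_zero, zero_sub] at h₀₀ h₀₁ h₁₁ h₀₂ h₂₀ h₀₃ h₁₂ h₁₃ h₂₂ h₂₃ h₃₂ h₃₃
  obtain ⟨h₀₀w, h₀₀x, h₀₀y, h₀₀z⟩ := h₀₀
  obtain ⟨h₀₁w, h₀₁x, h₀₁y, h₀₁z⟩ := h₀₁
  obtain ⟨h₁₁w, -, -, -⟩ := h₁₁
  obtain ⟨h₀₂w, h₀₂x, h₀₂y, h₀₂z⟩ := h₀₂
  obtain ⟨h₂₀w, h₂₀x, h₂₀y, h₂₀z⟩ := h₂₀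
  obtain ⟨h₀₃w, h₀₃x, h₀₃y, h₀₃z⟩ := h₀₃
  obtain ⟨-, -, h₁₂y, h₁₂z⟩ := h₁₂
  obtain ⟨-, -, h₁₃y, h₁₃z⟩ := h₁₃
  obtain ⟨h₂₂w, -, -, -⟩ := h₂₂
  obtain ⟨h₂₃w, h₂₃x, -, -⟩ := h₂₃
  obtain ⟨h₃₂w, -, -, -⟩ := h₃₂
  obtain ⟨h₃₃w, -, -, -⟩ := h₃₃
  rcases radical_coordinates (w₂ := w₂) (w₃ := w₃) (x₂ := x₂) (x₃ := x₃) (by linarith)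
    (by linarith) (by linarith) (by linarith) (by linarith) with
    ⟨rfl, rfl, rfl, rfl⟩ | ⟨ha, s, t, hs, ht, rfl, rfl, rfl⟩
  · rcases quotient_cases (w₀ := w₀) (w₁ := w₁) (x₀ := x₀) (x₁ := x₁) hl (by linarith)
      (by linarith) (by linarith) (by linarith) (by linarith) with
      ⟨rfl, rfl, hw⟩ | ⟨rfl, rfl, hw⟩ | ⟨rfl, rfl, hw⟩ | ⟨rfl, rfl, hw⟩
    -- With `x₀ = 0`, the pair `(1, 1)` gives `(2B + l) b₀ = 0`. Since `B² + lB = 0`, one has `(2B +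
    -- l)² = l²`, so `b₀ = 0`; the coefficients below carry out this multiplication.
    · have hy₀ : y₀ = 0 := by
        apply mul_left_cancel₀ (pow_ne_zero 2 hl)
        linear_combination (-l - 2 * y₂) * h₀₀y - 2 * y₃ * h₀₀z
          + 4 * y₀ * h₀₂y + 4 * z₀ * h₀₃y
      have hz₀ : z₀ = 0 := by
        apply mul_left_cancel₀ (pow_ne_zero 2 hl)
        linear_combination (-l - 2 * z₃) * h₀₀z - 2 * z₂ * h₀₀y
          + 4 * y₀ * h₀₂z + 4 * z₀ * h₀₃z
      subst hy₀ hz₀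
      apply isListed_of_range hl hw <;> linarith
    · have hy₀ : y₀ = 0 := by
        apply mul_left_cancel₀ (pow_ne_zero 2 hl)
        linear_combination (-l - 2 * y₂) * h₀₀y - 2 * y₃ * h₀₀z
          + 4 * y₀ * h₀₂y + 4 * z₀ * h₀₃y
      have hz₀ : z₀ = 0 := by
        apply mul_left_cancel₀ (pow_ne_zero 2 hl)
        linear_combination (-l - 2 * z₃) * h₀₀z - 2 * z₂ * h₀₀y
          + 4 * y₀ * h₀₂z + 4 * z₀ * h₀₃z
      subst hy₀ hz₀
      apply isListed_of_ker hl hw <;> linarith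
    -- Comparing `(1, e₂)` with `(e₂, 1)` gives `x₀(SB - BS) = 0`, and `x₀ ≠ 0` here.
    · have hy₃ : y₃ = z₂ := mul_left_cancel₀ hl (by linarith)
      have hz₃ : z₃ = y₂ := mul_left_cancel₀ hl (by linarith)
      subst hy₃ hz₃
      apply isListed_of_commute_neg hl hw <;> linarith
    · have hy₃ : y₃ = z₂ := mul_left_cancel₀ hl (by linarith)
      have hz₃ : z₃ = y₂ := mul_left_cancel₀ hl (by linarith)
      subst hy₃ hz₃
      apply isListed_of_commute_pos hl hw <;> linarith
  · have hs' : s * s = 1 := by rcases hs with rfl | rfl <;> norm_num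
    have ht' : t * t = 1 := by rcases ht with rfl | rfl <;> norm_num
    -- Subtracting the identities for `(1, e₂)` and `(e₂, 1)` gives `[P(1), P(e₂)] = P([P(1), e₂])`.
    -- Its scalar part kills `x₀`; then its radical part kills `y₀` and `z₀`, as `P(e₂)` has nonzero
    -- `e₁`-coordinate.
    have hx₀ : x₀ = 0 := by
      apply mul_left_cancel₀ (mul_ne_zero two_ne_zero ha)
      linear_combination (-t) * (h₀₂w - h₂₀w) - 2 * x₀ * w₂ * ht'
    subst hx₀
    have hz₀ : z₀ = 0 := by
      apply mul_left_cancel₀ (mul_ne_zero two_ne_zero ha)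
      linear_combination (-s) * (h₀₂y - h₂₀y) - 2 * z₀ * w₂ * hs'
    have hy₀ : y₀ = 0 := by
      apply mul_left_cancel₀ (mul_ne_zero two_ne_zero ha)
      linear_combination (-s) * (h₀₂z - h₂₀z) - 2 * y₀ * w₂ * hs'
    subst hy₀ hz₀
    have hw₀ : w₀ = 0 ∨ w₀ = -l := by
      have : w₀ * (w₀ + l) = 0 := by linear_combination -h₀₀w
      exact (mul_eq_zero.1 this).imp_right eq_neg_of_add_eq_zero_left
    -- As `P(1)` is now scalar, pairing with `1` says `P² + lP = 0`. The next relations are its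
    -- entries, divided by `w₂ ≠ 0`.
    have hx₁ : x₁ + y₂ + t * z₂ + l = 0 := by
      apply mul_left_cancel₀ ha
      linear_combination (-s) * h₀₂x - w₂ * (x₁ + y₂ + t * z₂ + l) * hs'
    have hw₁ : w₀ + s * w₁ + y₂ + t * z₂ + l = 0 := by
      apply mul_left_cancel₀ ha
      linear_combination -h₀₂w
    have hy₃ : t * x₁ + y₃ + t * z₃ + l * t = 0 := by
      apply mul_left_cancel₀ ha
      linear_combination (-s) * h₀₃x - w₂ * (t * x₁ + y₃ + t * z₃ + l * t) * hs'
    refine isListed_of_radical_ne_zero ha hs ht hw₀ (b := x₁) ?_ (by linarith) (by linarith)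
      (by linarith) ?_ ?_
    · linear_combination s * hw₁ - s * hx₁ - w₁ * hs'
    · linear_combination -h₀₂z
    -- Subtracting `t` times the `e₂` column from the `e₃` column eliminates `z₁`.
    · linear_combination -h₀₃z + t * h₀₂z + z₂ * t * hx₁ - z₂ * hy₃

end SplitSemiQuaternion

theorem theorem5p1 (l : ℝ) (hl : l ≠ 0) (P : SplitSemiQuaternion →ₗ[ℝ] SplitSemiQuaternion) :
    IsRotaBaxter l P ↔
      IsListed l (LinearMap.toMatrix SplitSemiQuaternion.stdBasis
        SplitSemiQuaternion.stdBasis P) := by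
  obtain ⟨M, rfl⟩ := (Matrix.toLin SplitSemiQuaternion.stdBasis
    SplitSemiQuaternion.stdBasis).surjective P
  rw [LinearMap.toMatrix_toLin]
  constructor
  · intro h
    rw [SplitSemiQuaternion.matrix_eq_entries M] at h ⊢
    exact SplitSemiQuaternion.isListed_of_isRotaBaxter hl h
  · rintro (⟨a, b, hM⟩ | ⟨a, b, c, ha, hM⟩ | ⟨a, b, hb, hM⟩ | ⟨a, b, hb, hM⟩)
    · exact SplitSemiQuaternion.polynomialFamilies_isRotaBaxter hM
    · exact SplitSemiQuaternion.familiesOverA_isRotaBaxter ha hM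
    · exact SplitSemiQuaternion.familiesOverSum_isRotaBaxter hb hM
    · exact SplitSemiQuaternion.familiesOverDiff_isRotaBaxter hb hM
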